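/- A $V_4$-quartic field is a Galois extension $K/\mathbf{Q}$ of degree $4$ whose Galois group is the Klein four-group. It is tame (tamely ramified) if for every prime number $p$ and every prime ideal $\mathfrak{p}$ of $\mathcal{O}_K$ above $p$, the ramification index of $\mathfrak{p}$ over $p$ is not divisible by $p$. The shape of a rank $d$ lattice $\Lambda$ in a real inner product space is its equivalence class under orthogonal transformations and homotheties, encoded as the double coset $\mathrm{sh}(\Lambda)=\mathrm{GL}_d(\mathbf{Z})\cdot G_B\cdot\mathbf{R}^\times=\{\lambda^2\, gG_Bg^T : g\in\mathrm{GL}_d(\mathbf{Z}),\ \lambda\in\mathbf{R}^\times\}$, where $G_B$ is the Gram matrix of any $\mathbf{Z}$-basis $B$ of $\Lambda$. For a number field $K$ of degree $n$ with complex embeddings $\sigma_1,\dots,\sigma_n$, let $j:K\to\mathbf{C}^n$, $j(\alpha)=(\sigma_1(\alpha),\dots,\sigma_n(\alpha))$; the real span of $j(K)$ is an $n$-dimensional real inner product space under the standard Hermitian inner product of $\mathbf{C}^n$. The shape $\mathrm{sh}(K)$ of $K$ is the shape of the rank $n-1$ lattice obtained by projecting $j(\mathcal{O}_K)$ orthogonally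 onto the orthogonal complement of $j(1)$. **Corollary 4.12.** Let $K$ and $L$ be $V_4$-quartic fields with $\mathrm{sh}(K)=\mathrm{sh}(L)$. 1. If $K$ and $L$ are both totally real, then $K\cong L$. 2. If $K$ and $L$ are both tame, then $K\cong L$. -/

import Mathlib

noncomputable section

namespace QuarticShape

/-- The shape of a lattice `Λ` of rank `d` in a real inner product space, i.e. its class under
orthogonal transformations and homotheties, given as the double coset `GL_d(ℤ) · G_B · ℝˣ`: the set
of all positive rescalings `c² G_B` of the Gram matrices `G_B` of the `ℤ`-bases `B` of `Λ`.
(The change-of-basis action of `GL_d(ℤ)` is accounted for by letting `B` run through all bases.) -/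
def latticeShape {V : Type*} [NormedAddCommGroup V] [InnerProductSpace ℝ V]
    (d : ℕ) (Λ : Submodule ℤ V) : Set (Matrix (Fin d) (Fin d) ℝ) :=
  {G | ∃ (B : Module.Basis (Fin d) ℤ Λ) (c : ℝ), c ≠ 0 ∧
    G = c ^ 2 • Matrix.gram ℝ (fun i => (B i : V))}

section Field

variable (K : Type*) [Field K] [NumberField K]

/-- The space `ℂⁿ`, with coordinates indexed by the `n` complex embeddings of `K`, and with the real
inner product `Re ⟨·,·⟩` that underlies the standard Hermitian one. On the real span of the image
of the Minkowski embedding the two agree. -/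
abbrev EmbeddingSpace : Type _ := EuclideanSpace ℂ (K →+* ℂ)

/-- The Minkowski embedding `α ↦ (σ(α))_σ`, restricted to the ring of integers of `K`. -/
def minkowski : NumberField.RingOfIntegers K →ₗ[ℤ] EmbeddingSpace K where
  toFun α := WithLp.toLp 2 (NumberField.canonicalEmbedding K (α : K))
  map_add' α β := by simp
  map_smul' m α := by ext σ; simp

/-- The lattice `Λ_K^⊥`: the orthogonal projection of the image of the ring of integers under the
Minkowski embedding `j` onto the orthogonal complement of the vector `j(1)`. -/
def perpLattice : Submodule ℤ (EmbeddingSpace K) :=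
  (LinearMap.range (minkowski K)).map
    ((ℝ ∙ minkowski K 1)ᗮ.starProjection.toLinearMap.restrictScalars ℤ)

/-- The shape of a quartic number field `K`: the shape of the rank `3` lattice `Λ_K^⊥`. -/
def quarticShape : Set (Matrix (Fin 3) (Fin 3) ℝ) :=
  latticeShape 3 (perpLattice K)

/-- `K` is a `V₄`-quartic field: a quartic Galois extension of `ℚ` with Galois group the Klein
four-group. -/
structure IsV4Quartic : Prop where
  finrank_eq : Module.finrank ℚ K = 4
  isGalois : IsGalois ℚ K
  isKleinFour : IsKleinFour (K ≃ₐ[ℚ] K)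

/-- `K` is tamely ramified (over `ℚ`): for no prime `𝔭` of `K` does the residue characteristic `p`
divide the ramification index of `𝔭` over `p`. -/
def IsTame : Prop :=
  ∀ (p : ℕ), p.Prime → ∀ (P : Ideal (NumberField.RingOfIntegers K)), P.IsPrime →
    P.LiesOver (Ideal.span {(p : ℤ)}) → ¬ p ∣ P.ramificationIdx ℤ

end Field

end QuarticShape

end

/-!
Let `K` be a `V₄`-quartic field, with quadratic subfields `ℚ(√d i)` for `i = 0, 1, 2`. The Galois
group permutes the complex embeddings, hence acts on the lattice by isometries: a nontrivial
automorphism acts as a half-turn about one of the pairwise orthogonal vectors `j(√d i)`. The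
negatives of the half-turns, the reflections along these vectors, therefore preserve the lattice as
well. This gives an orthogonal frame (`IsOrthogonalFrame`): lattice vectors `u i` on the three axes
such that twice any lattice vector is an integral combination of them. Up to rational squares,
`‖u i‖²` is `|d i|`.

Fields `K` and `L` of the same shape have similar lattices. The image `w` of a frame vector of `K`
is the axis of a reflection of the lattice of `L`. Write `2 w = ∑ i, n i • u' i` in the frame `u'`
of `L`. Integrality of the reflection makes the quotients `N i = n i² ‖u' i‖² / ‖w‖²` nonnegative
integers, and `N 0 + N 1 + N 2 = 4`. If some `N i` is `1` or `4`, then `‖w‖²` is `‖u' i‖²` up to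
squares. Otherwise two of the `N i` are `2`, and two of the `‖u' i‖²` agree up to squares, which is
impossible unless `-1` is a square in `L` (`IsOrthogonalFrame.exists_norm_sq_eq`). Hence `|d k|`
agrees with some `|e j|` up to squares, where the `ℚ(√e j)` are the quadratic subfields of `L`
(`IsSqrtBasis.exists_abs_eq`).

It remains to recover the signs. In a totally real field all `d i` are positive. In a tame field,
the only squarefree integers with a square root are congruent to `1` modulo `4`
(`IsTame.emod_four_eq_one`), and of `m` and `-m` at most one is of this kind. So every `√d k` lies
in `L`, whence `K ≅ L`.
-/

namespace QuarticShape

open NumberField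

open scoped RealInnerProductSpace

/-! ### Lattices with an orthogonal frame -/

section Lattice

variable {V V' : Type*} [NormedAddCommGroup V] [InnerProductSpace ℝ V]
  [NormedAddCommGroup V'] [InnerProductSpace ℝ V']

/-- Three pairwise orthogonal nonzero vectors `u i` of the lattice `Λ` such that twice every vector
of `Λ` is an integral combination of them. Thus `Λ` has rank three, and twice the projection of a
vector of `Λ` to the line of `u i` is an integral multiple of `u i`, so that the reflection along
`u i` preserves `Λ`. -/
structure IsOrthogonalFrame (Λ : Submodule ℤ V) (u : Fin 3 → V) : Prop where
  mem : ∀ i, u i ∈ Λ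
  ne_zero : ∀ i, u i ≠ 0
  inner_eq_zero : ∀ i j, i ≠ j → ⟪u i, u j⟫ = 0
  two_smul_eq : ∀ v ∈ Λ, ∃ n : Fin 3 → ℤ, (2 : ℝ) • v = ∑ i, (n i : ℝ) • u i

theorem IsOrthogonalFrame.inner_sum {Λ : Submodule ℤ V} {u : Fin 3 → V}
    (hu : IsOrthogonalFrame Λ u) (n : Fin 3 → ℝ) (i : Fin 3) :
    ⟪u i, ∑ l, n l • u l⟫ = n i * ‖u i‖ ^ 2 := by
  rw [_root_.inner_sum, Finset.sum_eq_single i]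
  · rw [real_inner_smul_right, real_inner_self_eq_norm_sq]
  · intro l _ hl
    rw [real_inner_smul_right, hu.inner_eq_zero i l hl.symm, mul_zero]
  · simp

/-- A criterion for the projection of a lattice `M` along `e` to have an orthogonal frame, in terms
of the coordinates of the vectors of `M` with respect to `e` and three further vectors `v i`. -/
theorem isOrthogonalFrame_map_starProjection {M : Submodule ℤ V} {e : V} {v : Fin 3 → V}
    {c : Fin 3 → ℝ} (hev : ∀ i, ⟪e, v i⟫ = 0) (hv : ∀ i j, i ≠ j → ⟪v i, v j⟫ = 0)
    (hv0 : ∀ i, v i ≠ 0) (hc : ∀ i, c i ≠ 0) (hmem : ∀ i, ∃ x ∈ M, ∃ t : ℝ, x = t • e + c i • v i)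
    (hM : ∀ x ∈ M, ∃ (t : ℝ) (n : Fin 3 → ℤ), x = t • e + ∑ i, (n i * c i / 2) • v i) :
    IsOrthogonalFrame (M.map ((ℝ ∙ e)ᗮ.starProjection.toLinearMap.restrictScalars ℤ))
      (fun i => c i • v i) := by
  have hproj : ∀ (t : ℝ) (y : V), ⟪e, y⟫ = 0 → (ℝ ∙ e)ᗮ.starProjection (t • e + y) = y := by
    intro t y hy
    apply Submodule.eq_starProjection_of_mem_of_inner_eq_zero
    · rwa [Submodule.mem_orthogonal_singleton_iff_inner_right]
    · intro w hw
      rw [add_sub_cancel_right, real_inner_smul_left,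
        Submodule.mem_orthogonal_singleton_iff_inner_right.1 hw, mul_zero]
  refine ⟨?_, fun i => smul_ne_zero (hc i) (hv0 i), ?_, ?_⟩
  · intro i
    obtain ⟨x, hx, t, rfl⟩ := hmem i
    exact ⟨_, hx, hproj t _ (by rw [real_inner_smul_right, hev, mul_zero])⟩
  · intro i j hij
    rw [real_inner_smul_left, real_inner_smul_right, hv i j hij, mul_zero, mul_zero]
  · rintro _ ⟨x, hx, rfl⟩
    obtain ⟨t, n, rfl⟩ := hM x hx
    refine ⟨n, ?_⟩
    change (2 : ℝ) • (ℝ ∙ e)ᗮ.starProjection _ = _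
    rw [hproj, Finset.smul_sum]
    · refine Finset.sum_congr rfl fun i _ => ?_
      rw [smul_smul, smul_smul]
      congr 1
      ring
    · rw [_root_.inner_sum]
      exact Finset.sum_eq_zero fun i _ => by rw [real_inner_smul_right, hev, mul_zero]

theorem IsOrthogonalFrame.linearIndependent {Λ : Submodule ℤ V} {u : Fin 3 → V}
    (hu : IsOrthogonalFrame Λ u) : LinearIndependent ℝ u :=
  linearIndependent_of_ne_zero_of_inner_eq_zero hu.ne_zero fun i j h => hu.inner_eq_zero i j h

/-- A lattice with an orthogonal frame is free of rank three. -/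
theorem IsOrthogonalFrame.nonempty_basis {Λ : Submodule ℤ V} {u : Fin 3 → V}
    (hu : IsOrthogonalFrame Λ u) : Nonempty (Module.Basis (Fin 3) ℤ Λ) := by
  have hint : LinearIndependent ℤ u := hu.linearIndependent.restrict_scalars' ℤ
  let M : Submodule ℤ V := Submodule.span ℤ (Set.range u)
  let b : Module.Basis (Fin 3) ℤ M := Module.Basis.span hint
  have : Module.Free ℤ M := .of_basis b
  have : Module.Finite ℤ M := .of_basis b
  have hM : Module.finrank ℤ M = 3 := by rw [Module.finrank_eq_card_basis b]; simp
  -- doubling embeds `Λ` into the lattice `M` spanned by the frame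
  let f : Λ →ₗ[ℤ] M := LinearMap.codRestrict M ((2 : ℤ) • Λ.subtype) (by
    intro v
    obtain ⟨n, hn⟩ := hu.two_smul_eq v v.2
    have h2 : ((2 : ℤ) • Λ.subtype) v = ∑ i, n i • u i := by
      simp only [LinearMap.smul_apply, Submodule.subtype_apply, ← Int.cast_smul_eq_zsmul ℝ]
      simpa using hn
    rw [h2]
    exact Submodule.sum_mem _ fun i _ => Submodule.smul_mem _ _ (Submodule.subset_span ⟨i, rfl⟩))
  have hf : Function.Injective f := by
    rw [← LinearMap.ker_eq_bot, LinearMap.ker_eq_bot']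
    intro v hv
    have h2 : (2 : ℤ) • (v : V) = 0 := congrArg Subtype.val hv
    rw [← Int.cast_smul_eq_zsmul ℝ, smul_eq_zero] at h2
    exact Subtype.ext (h2.resolve_left (by norm_num))
  have hML : M ≤ Λ := Submodule.span_le.2 (by rintro _ ⟨i, rfl⟩; exact hu.mem i)
  have hfin : Module.Finite ℤ Λ := Module.Finite.of_injective f hf
  have hfree : Module.Free ℤ Λ := Module.Free.of_equiv (LinearEquiv.ofInjective f hf).symm
  have h1 : Module.finrank ℤ Λ ≤ 3 := hM ▸ LinearMap.finrank_le_finrank_of_injective hf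
  have h2 : 3 ≤ Module.finrank ℤ Λ :=
    hM ▸ LinearMap.finrank_le_finrank_of_injective (Submodule.inclusion_injective hML)
  exact ⟨Module.finBasisOfFinrankEq ℤ Λ (le_antisymm h1 h2)⟩

/-- Lattices of the same shape are similar. -/
theorem exists_similarity_of_latticeShape_eq {d : ℕ} {Λ : Submodule ℤ V} {Λ' : Submodule ℤ V'}
    (hne : Nonempty (Module.Basis (Fin d) ℤ Λ))
    (h : latticeShape d Λ = latticeShape d Λ') :
    ∃ (φ : Λ ≃ₗ[ℤ] Λ') (t : ℝ), 0 < t ∧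
      ∀ v w : Λ, ⟪(φ v : V'), (φ w : V')⟫ = t * ⟪(v : V), (w : V)⟫ := by
  obtain ⟨B⟩ := hne
  have hmem : Matrix.gram ℝ (fun i => (B i : V)) ∈ latticeShape d Λ :=
    ⟨B, 1, one_ne_zero, by simp⟩
  rw [h] at hmem
  obtain ⟨B', c, hc, hG⟩ := hmem
  have hc2 : 0 < c ^ 2 := by positivity
  refine ⟨B.equiv B' (Equiv.refl _), (c ^ 2)⁻¹, by positivity, fun v w => ?_⟩
  have hB : ∀ i j, ⟪(B' i : V'), (B' j : V')⟫ = (c ^ 2)⁻¹ * ⟪(B i : V), (B j : V)⟫ := by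
    intro i j
    have := congrFun (congrFun hG i) j
    simp only [Matrix.gram_apply, Matrix.smul_apply, smul_eq_mul] at this
    rw [this, inv_mul_cancel_left₀ hc2.ne']
  have hexp : ∀ v : Λ, (v : V) = ∑ i, (B.repr v i : ℝ) • (B i : V) := by
    intro v
    have := congrArg Subtype.val (B.sum_repr v)
    simpa [Int.cast_smul_eq_zsmul, -Module.Basis.sum_repr] using this.symm
  have hexp' : ∀ v : Λ, ((B.equiv B' (Equiv.refl _)) v : V')
      = ∑ i, (B.repr v i : ℝ) • (B' i : V') := by
    intro v
    have := congrArg (fun x => (B.equiv B' (Equiv.refl _) x : V')) (B.sum_repr v)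
    simpa [Int.cast_smul_eq_zsmul, -Module.Basis.sum_repr] using this.symm
  rw [hexp' v, hexp' w, hexp v, hexp w]
  simp only [sum_inner, _root_.inner_sum, real_inner_smul_left, real_inner_smul_right, hB,
    Finset.mul_sum]
  refine Finset.sum_congr rfl fun i _ => Finset.sum_congr rfl fun j _ => ?_
  ring

/-- Under a similarity of ratio `t`, every vector of an orthogonal frame of `Λ` goes to a vector
of `Λ'` whose squared length is, up to rational squares, that of a vector of the frame of `Λ'`,
provided these latter are distinct up to rational squares.

The image `w` of `u j` is again the axis of a reflection of `Λ'`. If `2 w = ∑ i, n i • u' i`, this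
makes `k i = n i ‖u' i‖² / ‖w‖²` an integer, and `∑ i, k i n i = 4` with nonnegative summands. -/
theorem IsOrthogonalFrame.exists_norm_sq_eq {Λ : Submodule ℤ V} {Λ' : Submodule ℤ V'}
    {u : Fin 3 → V} {u' : Fin 3 → V'}
    (hu : IsOrthogonalFrame Λ u) (hu' : IsOrthogonalFrame Λ' u') (φ : Λ ≃ₗ[ℤ] Λ') {t : ℝ}
    (ht : 0 < t) (hφ : ∀ v w : Λ, ⟪(φ v : V'), (φ w : V')⟫ = t * ⟪(v : V), (w : V)⟫)
    (hns : ∀ i j, i ≠ j → ∀ s : ℚ, ‖u' i‖ ^ 2 ≠ s ^ 2 * ‖u' j‖ ^ 2) (j : Fin 3) :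
    ∃ (i : Fin 3) (s : ℚ), s ≠ 0 ∧ t * ‖u j‖ ^ 2 = s ^ 2 * ‖u' i‖ ^ 2 := by
  have hQ : ∀ i, 0 < ‖u i‖ ^ 2 := fun i => by have := norm_pos_iff.2 (hu.ne_zero i); positivity
  set w : Λ' := φ ⟨u j, hu.mem j⟩ with hw
  set q : ℝ := t * ‖u j‖ ^ 2 with hq
  have hq0 : 0 < q := mul_pos ht (hQ j)
  have hwq : ⟪(w : V'), (w : V')⟫ = q := by rw [hw, hφ, real_inner_self_eq_norm_sq]
  obtain ⟨n, hn⟩ := hu'.two_smul_eq w w.2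
  have hk : ∀ i, ∃ k : ℤ, (n i : ℝ) * ‖u' i‖ ^ 2 = k * q := by
    intro i
    set v : Λ := φ.symm ⟨u' i, hu'.mem i⟩ with hv
    obtain ⟨m, hm⟩ := hu.two_smul_eq v v.2
    refine ⟨m j, ?_⟩
    rw [← hu'.inner_sum (fun l => (n l : ℝ)), ← hn, real_inner_smul_right]
    have h1 : ⟪u' i, (w : V')⟫ = t * ⟪(v : V), u j⟫ := by
      have := hφ v ⟨u j, hu.mem j⟩
      rwa [hv, LinearEquiv.apply_symm_apply] at this
    have h2 : 2 * ⟪(v : V), u j⟫ = m j * ‖u j‖ ^ 2 := by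
      rw [← hu.inner_sum (fun l => (m l : ℝ)), ← hm, real_inner_smul_right, real_inner_comm]
    rw [h1, hq]
    linear_combination t * h2
  choose k hk using hk
  have hsq : ∀ i, ((k i * n i : ℤ) : ℝ) * q = n i ^ 2 * ‖u' i‖ ^ 2 := by
    intro i
    push_cast
    linear_combination -(n i : ℝ) * hk i
  have hpos : ∀ i, 0 ≤ k i * n i := by
    intro i
    have : 0 ≤ ((k i * n i : ℤ) : ℝ) * q := by rw [hsq]; positivity
    exact_mod_cast nonneg_of_mul_nonneg_left this hq0
  have hsum : k 0 * n 0 + k 1 * n 1 + k 2 * n 2 = 4 := by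
    have h4 : ⟪(2 : ℝ) • (w : V'), (2 : ℝ) • (w : V')⟫ = 4 * q := by
      rw [real_inner_smul_left, real_inner_smul_right, hwq]; ring
    conv_lhs at h4 => rw [hn]
    rw [sum_inner] at h4
    simp only [real_inner_smul_left] at h4
    simp only [hu'.inner_sum (fun l => (n l : ℝ))] at h4
    have h5 : ((k 0 * n 0 + k 1 * n 1 + k 2 * n 2 : ℤ) : ℝ) * q = (4 : ℤ) * q := by
      rw [Fin.sum_univ_three] at h4
      have h0 := hsq 0
      have h1 := hsq 1
      have h2 := hsq 2
      push_cast at h0 h1 h2 ⊢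
      linear_combination h0 + h1 + h2 + h4
    exact_mod_cast mul_right_cancel₀ hq0.ne' h5
  have hn0 : ∀ i, k i * n i ≠ 0 → (n i : ℝ) ≠ 0 := fun i hi h =>
    hi (by rw [show n i = 0 by exact_mod_cast h, mul_zero])
  -- two summands equal to `2` would make two of the `‖u' i‖²` agree up to squares
  have htwo : ∀ i l, i ≠ l → k i * n i = 2 → k l * n l = 2 → False := by
    intro i l hil hi hl
    have h1 := hsq i
    have h2 := hsq l
    rw [hi] at h1
    rw [hl] at h2
    have hni := hn0 i (by omega)
    refine hns i l hil (n l / n i) ?_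
    push_cast
    field_simp
    linear_combination h2 - h1
  by_cases h14 : ∃ i, k i * n i = 1 ∨ k i * n i = 4
  · obtain ⟨i, hi⟩ := h14
    have hni := hn0 i (by omega)
    have h1 := hsq i
    rcases hi with hi | hi
    · rw [hi] at h1
      exact ⟨i, n i, by exact_mod_cast hni, by push_cast at h1 ⊢; linarith⟩
    · rw [hi] at h1
      refine ⟨i, n i / 2, div_ne_zero (by exact_mod_cast hni) two_ne_zero, ?_⟩
      push_cast at h1 ⊢
      linear_combination h1 / 4
  · exfalso
    push Not at h14
    have key : ∀ a b c : ℤ, a + b + c = 4 → 0 ≤ a → 0 ≤ b → 0 ≤ c → (a ≠ 1 ∧ a ≠ 4) →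
        (b ≠ 1 ∧ b ≠ 4) → (c ≠ 1 ∧ c ≠ 4) →
        (a = 2 ∧ b = 2) ∨ (a = 2 ∧ c = 2) ∨ (b = 2 ∧ c = 2) := by
      intros
      omega
    rcases key _ _ _ hsum (hpos 0) (hpos 1) (hpos 2) (h14 0) (h14 1) (h14 2) with h | h | h
    · exact htwo 0 1 (by decide) h.1 h.2
    · exact htwo 0 2 (by decide) h.1 h.2
    · exact htwo 1 2 (by decide) h.1 h.2

end Lattice

/-! ### The square roots that generate a biquadratic field -/

section Field

variable {K : Type*} [Field K] [NumberField K]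

/-- The Galois-theoretic skeleton of a `V₄`-quartic field `K = ℚ(√d₀, √d₁)`: the three nontrivial
automorphisms `g i`, and integral square roots `α i` of rational numbers `d i`, with `α i` fixed by
`g i` and negated by the other two. -/
structure IsSqrtBasis (g : Fin 3 → K ≃ₐ[ℚ] K) (α : Fin 3 → 𝓞 K) (d : Fin 3 → ℚ) : Prop where
  sum_eq : ∀ f : (K ≃ₐ[ℚ] K) → K, ∑ σ, f σ = f 1 + ∑ i, f (g i)
  ne_zero : ∀ i, (α i : K) ≠ 0
  apply_eq : ∀ i l, g i (α l) = if l = i then (α l : K) else -α l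
  sq_eq : ∀ i, (α i : K) ^ 2 = algebraMap ℚ K (d i)

theorem exists_isSqrtBasis (hK : IsV4Quartic K) :
    ∃ (g : Fin 3 → K ≃ₐ[ℚ] K) (α : Fin 3 → 𝓞 K) (d : Fin 3 → ℚ), IsSqrtBasis g α d := by
  classical
  obtain ⟨-, hgal, hG⟩ := hK
  have hcard : (Finset.univ : Finset (K ≃ₐ[ℚ] K)).card = 4 := IsKleinFour.card_four'
  obtain ⟨a, -, ha⟩ := Finset.exists_mem_notMem_of_card_lt_card
    (s := ({1} : Finset (K ≃ₐ[ℚ] K))) (t := Finset.univ) (by simp [hcard])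
  obtain ⟨b, -, hb⟩ := Finset.exists_mem_notMem_of_card_lt_card
    (s := ({1, a} : Finset (K ≃ₐ[ℚ] K))) (t := Finset.univ)
    (lt_of_le_of_lt Finset.card_le_two (by omega))
  simp only [Finset.mem_singleton, Finset.mem_insert, not_or] at ha hb
  have hab : a ≠ b := fun h => hb.2 h.symm
  have huniv := IsKleinFour.eq_finset_univ ha hb.1 hab
  have haa : a * a = 1 := IsKleinFour.mul_self a
  have hbb : b * b = 1 := IsKleinFour.mul_self b
  have hcomm : b * a = a * b := IsKleinFour.isMulCommutative.is_comm.comm b a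
  have haa' : ∀ x, a (a x) = x := fun x => DFunLike.congr_fun haa x
  have hbb' : ∀ x, b (b x) = x := fun x => DFunLike.congr_fun hbb x
  have hba' : ∀ x, b (a x) = a (b x) := fun x => DFunLike.congr_fun hcomm x
  have hab1 : a * b ≠ 1 := fun h => hab (by rw [← mul_left_cancel_iff (a := a), haa, h])
  have haba : a * b ≠ a := fun h => hb.1 (by simpa using h)
  have habb : a * b ≠ b := fun h => ha (by simpa using h)
  have hsum : ∀ f : (K ≃ₐ[ℚ] K) → K, ∑ σ, f σ = f 1 + (f a + f b + f (a * b)) := by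
    intro f
    rw [← huniv, Finset.sum_insert (by simp [hab1, haba, habb]),
      Finset.sum_insert (by simp [hab, ha]), Finset.sum_insert (by simp [hb.1]),
      Finset.sum_singleton]
    ring
  -- independence of characters: no nontrivial combination of automorphisms vanishes
  have hind : ∀ p q r : K, ∃ x : K, x + (p * a x + q * b x + r * a (b x)) ≠ 0 := by
    intro p q r
    by_contra! h
    have hli : LinearIndependent K (fun σ : K ≃ₐ[ℚ] K => (σ : K → K)) :=
      (linearIndependent_monoidHom K K).comp (fun σ : K ≃ₐ[ℚ] K => (σ : K →* K))
        fun σ τ h => AlgEquiv.ext fun x => DFunLike.congr_fun h x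
    have h1 := Fintype.linearIndependent_iff.1 hli
      (fun σ => if σ = 1 then 1 else if σ = a then p else if σ = b then q else r) (by
        funext x
        rw [Finset.sum_apply, hsum]
        simpa [ha, hb.1, hab1, haba, habb, hb.2] using h x) 1
    simp at h1
  obtain ⟨x, hx⟩ := hind 1 (-1) (-1)
  obtain ⟨y, hy⟩ := hind (-1) 1 (-1)
  obtain ⟨z, hz⟩ := hind (-1) (-1) 1
  let β : Fin 3 → K := ![x + (1 * a x + (-1) * b x + (-1) * a (b x)),
    y + ((-1) * a y + 1 * b y + (-1) * a (b y)), z + ((-1) * a z + (-1) * b z + 1 * a (b z))]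
  let g : Fin 3 → K ≃ₐ[ℚ] K := ![a, b, a * b]
  have hβ0 : ∀ i, β i ≠ 0 := by
    intro i
    fin_cases i
    exacts [hx, hy, hz]
  have hβ : ∀ i l, g i (β l) = if l = i then β l else -β l := by
    intro i l
    fin_cases i <;> fin_cases l <;>
      simp [g, β, haa', hbb', hba'] <;> ring
  have hint : ∀ i, ∃ n : ℤ, n ≠ 0 ∧ IsIntegral ℤ (n • β i) := fun i =>
    ((IsFractionRing.isAlgebraic_iff ℤ ℚ K).2
      (Algebra.IsAlgebraic.isAlgebraic (β i))).exists_integral_multiple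
  choose n hn0 hn using hint
  let α : Fin 3 → 𝓞 K := fun i => ⟨n i • β i, hn i⟩
  have hα : ∀ i, (α i : K) = n i • β i := fun i => rfl
  have hα0 : ∀ i, (α i : K) ≠ 0 := fun i => by
    rw [hα]
    exact smul_ne_zero (hn0 i) (hβ0 i)
  have happ : ∀ i l, g i (α l) = if l = i then (α l : K) else -α l := by
    intro i l
    rw [hα, map_zsmul, hβ]
    split_ifs <;> simp
  have hgsum : ∀ f : (K ≃ₐ[ℚ] K) → K, ∑ σ, f σ = f 1 + ∑ i, f (g i) := by
    intro f
    rw [hsum, Fin.sum_univ_three]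
    rfl
  have hd : ∀ i, ∃ q : ℚ, (α i : K) ^ 2 = algebraMap ℚ K q := by
    intro l
    have hfix : ∀ i, g i ((α l : K) ^ 2) = (α l : K) ^ 2 := by
      intro i
      rw [map_pow, happ]
      split_ifs <;> simp
    have hmem : (α l : K) ^ 2 ∈ (⊥ : IntermediateField ℚ K) := by
      rw [IsGalois.mem_bot_iff_fixed]
      intro σ
      have hσ : σ ∈ ({a * b, a, b, 1} : Finset (K ≃ₐ[ℚ] K)) := huniv ▸ Finset.mem_univ σ
      simp only [Finset.mem_insert, Finset.mem_singleton] at hσ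
      rcases hσ with rfl | rfl | rfl | rfl
      exacts [hfix 2, hfix 0, hfix 1, rfl]
    obtain ⟨q, hq⟩ := IntermediateField.mem_bot.1 hmem
    exact ⟨q, hq.symm⟩
  choose d hd using hd
  exact ⟨g, α, d, hgsum, hα0, happ, hd⟩

namespace IsSqrtBasis

variable {g : Fin 3 → K ≃ₐ[ℚ] K} {α : Fin 3 → 𝓞 K} {d : Fin 3 → ℚ}

theorem d_ne_zero (h : IsSqrtBasis g α d) (i : Fin 3) : d i ≠ 0 := fun h0 => h.ne_zero i <| by
  simpa [h0] using h.sq_eq i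

theorem d_ne_sq (h : IsSqrtBasis g α d) (i : Fin 3) (s : ℚ) : d i ≠ s ^ 2 := by
  intro hs
  obtain ⟨l, hl⟩ : ∃ l, i ≠ l := ⟨i + 1, by fin_cases i <;> decide⟩
  have h1 : (α i : K) ^ 2 = (algebraMap ℚ K s) ^ 2 := by rw [h.sq_eq, hs, map_pow]
  have h2 := h.apply_eq l i
  rw [if_neg hl] at h2
  have h3 : g l (α i) = α i := by
    rcases sq_eq_sq_iff_eq_or_eq_neg.1 h1 with h4 | h4 <;> rw [h4] <;> simp
  exact h.ne_zero i (self_eq_neg.1 (h3.symm.trans h2))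

theorem algebraMap_trace [IsGalois ℚ K] (h : IsSqrtBasis g α d) (x : K) :
    algebraMap ℚ K (Algebra.trace ℚ K x) = x + ∑ i, g i x := by
  rw [trace_eq_sum_automorphisms, h.sum_eq]
  rfl

/-- The expansion of `x` in the basis `1, α 0, α 1, α 2`, which is orthogonal for the trace form. -/
theorem four_mul_eq [IsGalois ℚ K] (h : IsSqrtBasis g α d) (x : K) :
    4 * x = algebraMap ℚ K (Algebra.trace ℚ K x) +
      ∑ l, algebraMap ℚ K (Algebra.trace ℚ K (x * α l) / d l) * α l := by
  have hl : ∀ l, algebraMap ℚ K (Algebra.trace ℚ K (x * α l) / d l) * α l =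
      x + ∑ i, if l = i then g i x else -g i x := by
    intro l
    rw [map_div₀, h.algebraMap_trace, ← h.sq_eq]
    simp only [map_mul, h.apply_eq]
    have := h.ne_zero l
    field_simp
    rw [mul_add, Finset.mul_sum, mul_comm]
    congr 1
    refine Finset.sum_congr rfl fun i _ => ?_
    split_ifs with hli
    · rw [hli, mul_comm]
    · ring
  simp only [hl, h.algebraMap_trace, Fin.sum_univ_three]
  simp
  ring

/-- The product of the `d i` is a square, being that of the rational number `α 0 * α 1 * α 2`. -/
theorem exists_mul_mul_eq_sq [IsGalois ℚ K] (h : IsSqrtBasis g α d) :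
    ∃ q : ℚ, d 0 * d 1 * d 2 = q ^ 2 := by
  have hfix : 4 * ((α 0 : K) * α 1 * α 2) =
      algebraMap ℚ K (Algebra.trace ℚ K ((α 0 : K) * α 1 * α 2)) := by
    rw [h.algebraMap_trace, Fin.sum_univ_three]
    simp only [map_mul, h.apply_eq]
    simp
    ring
  refine ⟨Algebra.trace ℚ K ((α 0 : K) * α 1 * α 2) / 4, ?_⟩
  apply (algebraMap ℚ K).injective
  have h4 : (4 : K) ≠ 0 := by norm_num
  rw [map_pow, map_div₀, ← hfix, map_mul, map_mul, ← h.sq_eq, ← h.sq_eq, ← h.sq_eq, map_ofNat]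
  field_simp

/-- If every `d i` is a square in `L`, a number field of the same degree, then `L ≅ K`. -/
theorem nonempty_algEquiv [IsGalois ℚ K] (h : IsSqrtBasis g α d) {L : Type*} [Field L]
    [NumberField L] (hdeg : Module.finrank ℚ K = Module.finrank ℚ L)
    (hsq : ∀ i, ∃ β : L, β ^ 2 = algebraMap ℚ L (d i)) : Nonempty (K ≃ₐ[ℚ] L) := by
  have htop : IntermediateField.adjoin ℚ (Set.range fun i => (α i : K)) = ⊤ := by
    rw [eq_top_iff]
    intro x _
    set F := IntermediateField.adjoin ℚ (Set.range fun i => (α i : K)) with hF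
    have h4 : (4 : K) ≠ 0 := by norm_num
    have hx : x = (4 : K)⁻¹ * (4 * x) := (inv_mul_cancel_left₀ h4 x).symm
    rw [hx, h.four_mul_eq]
    refine F.mul_mem (F.inv_mem (ofNat_mem F 4)) (F.add_mem (F.algebraMap_mem _)
      (F.sum_mem fun l _ => F.mul_mem (F.algebraMap_mem _)
        (IntermediateField.subset_adjoin ℚ _ ⟨l, rfl⟩)))
  have hsplit : ∀ s ∈ Set.range (fun i => (α i : K)),
      IsIntegral ℚ s ∧ ((minpoly ℚ s).map (algebraMap ℚ L)).Splits := by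
    rintro _ ⟨i, rfl⟩
    refine ⟨Algebra.IsIntegral.isIntegral _, ?_⟩
    obtain ⟨β, hβ⟩ := hsq i
    have hdvd : minpoly ℚ (α i : K) ∣ Polynomial.X ^ 2 - Polynomial.C (d i) :=
      minpoly.dvd _ _ (by simp [h.sq_eq])
    have hfac : (Polynomial.X ^ 2 - Polynomial.C (d i)).map (algebraMap ℚ L) =
        (Polynomial.X - Polynomial.C β) * (Polynomial.X + Polynomial.C β) := by
      rw [Polynomial.map_sub, Polynomial.map_pow, Polynomial.map_X, Polynomial.map_C, ← hβ,
        Polynomial.C_pow]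
      ring
    have hne : (Polynomial.X ^ 2 - Polynomial.C (d i)).map (algebraMap ℚ L) ≠ 0 :=
      ((Polynomial.monic_X_pow_sub_C (d i) two_ne_zero).map _).ne_zero
    refine Polynomial.Splits.of_dvd ?_ hne (Polynomial.map_dvd _ hdvd)
    rw [hfac]
    exact (Polynomial.Splits.X_sub_C β).mul (Polynomial.Splits.X_add_C β)
  obtain ⟨f⟩ := IntermediateField.nonempty_algHom_of_adjoin_splits hsplit htop
  have hbij : Function.Bijective f := by
    refine ⟨f.injective, ?_⟩
    exact (LinearMap.injective_iff_surjective_of_finrank_eq_finrank hdeg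
      (f := f.toLinearMap)).1 f.injective
  exact ⟨AlgEquiv.ofBijective f hbij⟩

end IsSqrtBasis

/-! ### The orthogonal frame of the lattice of a biquadratic field -/

theorem inner_minkowski (x y : 𝓞 K) :
    ⟪minkowski K x, minkowski K y⟫ = ∑ σ : K →+* ℂ, (σ y * starRingEnd ℂ (σ x)).re :=
  rfl

theorem inner_minkowski_eq_zero_of_apply (g : K ≃ₐ[ℚ] K) {x y : 𝓞 K} (hx : g x = (x : K))
    (hy : g y = -(y : K)) : ⟪minkowski K x, minkowski K y⟫ = 0 := by
  let e : (K →+* ℂ) ≃ (K →+* ℂ) :=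
    { toFun := fun σ => σ.comp (g : K →+* K)
      invFun := fun σ => σ.comp (g.symm : K →+* K)
      left_inv := fun σ => by ext; simp
      right_inv := fun σ => by ext; simp }
  have h : ⟪minkowski K x, minkowski K y⟫ = -⟪minkowski K x, minkowski K y⟫ := by
    conv_lhs => rw [inner_minkowski, ← e.sum_comp]
    rw [inner_minkowski, ← Finset.sum_neg_distrib]
    refine Finset.sum_congr rfl fun σ _ => ?_
    simp [e, hx, hy]
  linarith

namespace IsSqrtBasis

variable {g : Fin 3 → K ≃ₐ[ℚ] K} {α : Fin 3 → 𝓞 K} {d : Fin 3 → ℚ}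

theorem inner_eq_zero (h : IsSqrtBasis g α d) {i l : Fin 3} (hil : i ≠ l) :
    ⟪minkowski K (α i), minkowski K (α l)⟫ = 0 :=
  inner_minkowski_eq_zero_of_apply (g i) (by simp [h.apply_eq]) (by simp [h.apply_eq, hil.symm])

theorem inner_one_eq_zero (h : IsSqrtBasis g α d) (l : Fin 3) :
    ⟪minkowski K 1, minkowski K (α l)⟫ = 0 := by
  obtain ⟨i, hi⟩ : ∃ i, l ≠ i := ⟨l + 1, by fin_cases l <;> decide⟩
  exact inner_minkowski_eq_zero_of_apply (g i) (by simp) (by simp [h.apply_eq, hi])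

theorem norm_minkowski_sq (h : IsSqrtBasis g α d) (hdeg : Module.finrank ℚ K = 4) (i : Fin 3) :
    ‖minkowski K (α i)‖ ^ 2 = 4 * |(d i : ℝ)| := by
  rw [← real_inner_self_eq_norm_sq, inner_minkowski]
  have hσ : ∀ σ : K →+* ℂ, (σ (α i) * starRingEnd ℂ (σ (α i))).re = |(d i : ℝ)| := by
    intro σ
    have h1 : σ (α i) ^ 2 = (d i : ℂ) := by rw [← map_pow, h.sq_eq]; simp
    have h2 : ‖σ (α i)‖ ^ 2 = |(d i : ℝ)| := by
      rw [← norm_pow, h1]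
      simp
    rw [Complex.mul_conj, Complex.ofReal_re, Complex.normSq_eq_norm_sq, h2]
  simp only [hσ, Finset.sum_const, Finset.card_univ, Embeddings.card, hdeg]
  simp

/-- The Minkowski embedding of the expansion of `x` in the basis `1, α 0, α 1, α 2`. -/
theorem minkowski_eq [IsGalois ℚ K] (h : IsSqrtBasis g α d) (x : 𝓞 K) :
    minkowski K x = ((Algebra.trace ℤ (𝓞 K) x : ℝ) / 4) • minkowski K 1 +
      ∑ l, ((Algebra.trace ℤ (𝓞 K) (x * α l) : ℝ) / (4 * d l)) • minkowski K (α l) := by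
  ext σ
  have h1 : (4 : ℂ) * σ x = ((Algebra.trace ℤ (𝓞 K) x : ℤ) : ℂ) +
      ∑ l, ((Algebra.trace ℤ (𝓞 K) (x * α l) : ℤ) : ℂ) / (d l : ℂ) * σ (α l) := by
    have h4 := congrArg σ (h.four_mul_eq (x : K))
    have hc : ∀ l, (x : K) * α l = ((x * α l : 𝓞 K) : K) := fun l => rfl
    simp only [hc, ← Algebra.coe_trace_int, map_add, map_sum] at h4
    rw [map_mul, map_ofNat] at h4
    simp only [map_mul σ (algebraMap ℚ K _)] at h4
    simpa [-map_mul] using h4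
  have hm : ∀ y : 𝓞 K, minkowski K y σ = σ y := fun y => rfl
  have hs : (∑ l, ((Algebra.trace ℤ (𝓞 K) (x * α l) : ℝ) / (4 * d l)) • minkowski K (α l)) σ =
      ∑ l, (((Algebra.trace ℤ (𝓞 K) (x * α l) : ℝ) / (4 * d l)) • σ (α l)) := by
    simp [hm]
  rw [PiLp.add_apply, hs, PiLp.smul_apply, hm, hm]
  simp only [Complex.real_smul]
  push_cast
  rw [map_one]
  rw [Fin.sum_univ_three] at h1 ⊢
  linear_combination h1 / 4

theorem exists_isOrthogonalFrame [IsGalois ℚ K] (h : IsSqrtBasis g α d)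
    (hdeg : Module.finrank ℚ K = 4) :
    ∃ u : Fin 3 → EmbeddingSpace K, IsOrthogonalFrame (perpLattice K) u ∧
      ∀ i, ∃ s : ℚ, s ≠ 0 ∧ ‖u i‖ ^ 2 = s ^ 2 * |(d i : ℝ)| := by
  let T : Fin 3 → 𝓞 K →ₗ[ℤ] ℤ := fun i => Algebra.trace ℤ (𝓞 K) ∘ₗ LinearMap.mulRight ℤ (α i)
  have hT : ∀ i x, T i x = Algebra.trace ℤ (𝓞 K) (x * α i) := fun i x => rfl
  have hTQ : ∀ i x, ((T i x : ℤ) : ℚ) = Algebra.trace ℚ K ((x : K) * α i) := fun i x => by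
    rw [hT, Algebra.coe_trace_int]
    rfl
  -- the values of `x ↦ Tr (x α i)` on the ring of integers form a nonzero ideal of `ℤ`
  have hgen : ∀ i, ∃ r : ℤ, r ≠ 0 ∧ (∃ x, T i x = r) ∧ ∀ x, ∃ m : ℤ, T i x = m * r := by
    intro i
    obtain ⟨r, hr⟩ := (IsPrincipalIdealRing.principal (LinearMap.range (T i))).principal
    have hdvd : ∀ x, ∃ m : ℤ, T i x = m * r := by
      intro x
      have hx : T i x ∈ LinearMap.range (T i) := ⟨x, rfl⟩
      rw [hr] at hx
      obtain ⟨m, hm⟩ := Submodule.mem_span_singleton.1 hx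
      exact ⟨m, hm.symm⟩
    refine ⟨r, ?_, ?_, hdvd⟩
    · rintro rfl
      obtain ⟨m, hm⟩ := hdvd (α i)
      have h1 := hTQ i (α i)
      rw [hm, ← pow_two, h.sq_eq, Algebra.trace_algebraMap, hdeg] at h1
      exact h.d_ne_zero i (by simpa using h1.symm)
    · have hmem : r ∈ LinearMap.range (T i) := hr ▸ Submodule.mem_span_singleton_self r
      exact hmem
  choose r hr0 hrx hrdvd using hgen
  have hd0 : ∀ i, (d i : ℝ) ≠ 0 := fun i => by exact_mod_cast h.d_ne_zero i
  have hr0' : ∀ i, (r i : ℝ) ≠ 0 := fun i => by exact_mod_cast hr0 i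
  have hd : ∀ i, 0 < |(d i : ℝ)| := fun i => abs_pos.2 (hd0 i)
  have hα0 : ∀ i, minkowski K (α i) ≠ 0 := by
    intro i h0
    have := h.norm_minkowski_sq hdeg i
    rw [h0, norm_zero] at this
    have := hd i
    linarith
  refine ⟨_, isOrthogonalFrame_map_starProjection (e := minkowski K 1)
    (v := fun i => minkowski K (α i)) (c := fun i => (r i : ℝ) / (2 * d i)) h.inner_one_eq_zero
    (fun i l hil => h.inner_eq_zero hil) hα0
    (fun i => div_ne_zero (hr0' i) (mul_ne_zero two_ne_zero (hd0 i))) ?_ ?_, ?_⟩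
  · -- if `Tr (x α i) = r i`, the `i`-th vector is the projection of `x + g i x`
    intro i
    obtain ⟨x, hx⟩ := hrx i
    let x' : 𝓞 K := ⟨g i x, x.2.map ((g i).toAlgHom.restrictScalars ℤ)⟩
    have htr : ∀ l, T l x' = if l = i then T l x else -T l x := by
      intro l
      have h1 : Algebra.trace ℚ K (g i x * α l) = if l = i then Algebra.trace ℚ K (x * α l : K)
          else -Algebra.trace ℚ K (x * α l : K) := by
        have h2 : g i x * α l = if l = i then g i (x * α l : K) else -g i (x * α l : K) := by
          rw [map_mul, h.apply_eq]
          split_ifs <;> ring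
        rw [h2]
        split_ifs
        · exact Algebra.trace_eq_of_algEquiv (g i) _
        · rw [map_neg, Algebra.trace_eq_of_algEquiv (g i)]
      have h3 : ((T l x' : ℤ) : ℚ) = if l = i then ((T l x : ℤ) : ℚ) else -(T l x : ℤ) := by
        rw [hTQ, hTQ]
        exact h1
      split_ifs at h3 ⊢ <;> exact_mod_cast h3
    refine ⟨minkowski K (x + x'), ⟨_, rfl⟩, (Algebra.trace ℤ (𝓞 K) (x + x') : ℝ) / 4, ?_⟩
    refine (h.minkowski_eq (x + x')).trans (congrArg _ ?_)
    rw [Finset.sum_eq_single i]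
    · have h1 : T i (x + x') = 2 * r i := by
        rw [map_add, htr, if_pos rfl, hx, two_mul]
      rw [← hT, h1]
      refine congrArg (fun a : ℝ => a • minkowski K (α i)) ?_
      push_cast
      have := hd0 i
      field_simp
      ring
    · intro l _ hl
      have h1 : T l (x + x') = 0 := by rw [map_add, htr, if_neg hl, add_neg_cancel]
      rw [← hT, h1]
      simp
    · simp
  · rintro _ ⟨x, rfl⟩
    choose m hm using fun i => hrdvd i x
    refine ⟨(Algebra.trace ℤ (𝓞 K) x : ℝ) / 4, m, ?_⟩
    refine (h.minkowski_eq x).trans (congrArg _ (Finset.sum_congr rfl fun l _ => ?_))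
    refine congrArg (fun a : ℝ => a • minkowski K (α l)) ?_
    rw [← hT, hm]
    push_cast
    have := hd0 l
    field_simp
    ring
  · intro i
    refine ⟨r i / d i, div_ne_zero (by exact_mod_cast hr0 i) (h.d_ne_zero i), ?_⟩
    rw [norm_smul, mul_pow, h.norm_minkowski_sq hdeg, Real.norm_eq_abs, sq_abs]
    push_cast
    have := hd0 i
    field_simp
    ring

/-! ### Comparing two fields of the same shape -/

theorem exists_abs_eq_mul_abs [IsGalois ℚ K] (h : IsSqrtBasis g α d) {i j l : Fin 3} (hij : i ≠ j)
    (hil : i ≠ l) (hjl : j ≠ l) : ∃ s : ℚ, s ≠ 0 ∧ |d i| = s ^ 2 * (|d j| * |d l|) := by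
  obtain ⟨q, hq⟩ := h.exists_mul_mul_eq_sq
  have h1 : d i * d j * d l = q ^ 2 := by
    rw [← hq]
    fin_cases i <;> fin_cases j <;> fin_cases l <;>
      simp only [Fin.isValue, Fin.zero_eta, Fin.mk_one, Fin.reduceFinMk, ne_eq,
        not_true_eq_false] at hij hil hjl ⊢ <;> ring
  have hj := h.d_ne_zero j
  have hl := h.d_ne_zero l
  refine ⟨q / (d j * d l), ?_, ?_⟩
  · refine div_ne_zero ?_ (mul_ne_zero hj hl)
    rintro rfl
    have := mul_ne_zero (mul_ne_zero (h.d_ne_zero i) hj) hl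
    rw [h1] at this
    simp at this
  · have h2 : d i = (q / (d j * d l)) ^ 2 * (d j * d l) := by
      field_simp
      linear_combination h1
    conv_lhs => rw [h2, abs_mul, abs_sq, abs_mul]

theorem abs_ne_sq_mul_abs [IsGalois ℚ K] (h : IsSqrtBasis g α d) (hns : ∀ i s, |d i| ≠ s ^ 2)
    {i j : Fin 3} (hij : i ≠ j) (s : ℚ) : |d i| ≠ s ^ 2 * |d j| := by
  intro hs
  obtain ⟨l, hli, hlj⟩ : ∃ l, l ≠ i ∧ l ≠ j := by
    clear hs
    revert i j
    decide
  obtain ⟨r, -, hr⟩ := h.exists_abs_eq_mul_abs hli hlj hij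
  refine hns l (r * s * |d j|) ?_
  rw [hr, hs]
  ring

/-- Two `V₄`-quartic fields of the same shape have, up to rational squares, the same `|d i|`.

The similarity gives `t |d k| ≡ |e (f k)|` modulo squares for some map `f`. Dividing two of these
relations eliminates `t`, and the product of two of the classes of `d` (or of `e`) is the third. -/
theorem exists_abs_eq [IsGalois ℚ K] (h : IsSqrtBasis g α d) (hdeg : Module.finrank ℚ K = 4)
    {L : Type*} [Field L] [NumberField L] [IsGalois ℚ L] {g' : Fin 3 → L ≃ₐ[ℚ] L}
    {β : Fin 3 → 𝓞 L} {e : Fin 3 → ℚ} (h' : IsSqrtBasis g' β e)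
    (hdeg' : Module.finrank ℚ L = 4) (hns : ∀ i s, |d i| ≠ s ^ 2) (hns' : ∀ i s, |e i| ≠ s ^ 2)
    (hsh : quarticShape K = quarticShape L) (k : Fin 3) :
    ∃ (j : Fin 3) (s : ℚ), |d k| = s ^ 2 * |e j| := by
  obtain ⟨u, hu, hud⟩ := h.exists_isOrthogonalFrame hdeg
  obtain ⟨u', hu', hue⟩ := h'.exists_isOrthogonalFrame hdeg'
  obtain ⟨φ, t, ht, hφ⟩ := exists_similarity_of_latticeShape_eq hu.nonempty_basis hsh
  choose a ha0 ha using hud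
  choose b hb0 hb using hue
  have hdist : ∀ i j, i ≠ j → ∀ s : ℚ, ‖u' i‖ ^ 2 ≠ s ^ 2 * ‖u' j‖ ^ 2 := by
    intro i j hij s hs
    rw [hb, hb] at hs
    have hs' : b i ^ 2 * |e i| = s ^ 2 * (b j ^ 2 * |e j|) := by exact_mod_cast hs
    refine h'.abs_ne_sq_mul_abs hns' hij (s * b j / b i) ?_
    have := hb0 i
    field_simp
    linear_combination hs'
  -- `t |d k| ≡ |e j|` modulo squares, for some `j`
  have hcls : ∀ k, ∃ (j : Fin 3) (s : ℚ), s ≠ 0 ∧ t * |(d k : ℝ)| = s ^ 2 * |(e j : ℝ)| := by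
    intro k
    obtain ⟨j, s, hs0, hs⟩ := hu.exists_norm_sq_eq hu' φ ht hφ hdist k
    refine ⟨j, s * b j / a k, div_ne_zero (mul_ne_zero hs0 (hb0 j)) (ha0 k), ?_⟩
    rw [ha, hb] at hs
    have : (a k : ℝ) ≠ 0 := by exact_mod_cast ha0 k
    push_cast
    field_simp
    linear_combination hs
  obtain ⟨i, l, hki, hkl, hil⟩ : ∃ i l, k ≠ i ∧ k ≠ l ∧ i ≠ l := by
    revert k
    decide
  obtain ⟨j₁, s₁, h10, h1⟩ := hcls i
  obtain ⟨j₂, s₂, h20, h2⟩ := hcls l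
  have hquot : s₂ ^ 2 * |e j₂| * |d i| = s₁ ^ 2 * |e j₁| * |d l| := by
    have : ((s₂ : ℝ) ^ 2 * |(e j₂ : ℝ)|) * |(d i : ℝ)| =
        ((s₁ : ℝ) ^ 2 * |(e j₁ : ℝ)|) * |(d l : ℝ)| := by
      rw [← h1, ← h2]; ring
    exact_mod_cast this
  have he2 : |e j₂| ≠ 0 := abs_ne_zero.2 (h'.d_ne_zero j₂)
  by_cases hj : j₁ = j₂
  · subst hj
    refine (h.abs_ne_sq_mul_abs hns hil (s₁ / s₂) ?_).elim
    field_simp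
    apply mul_left_cancel₀ he2
    linear_combination hquot
  · obtain ⟨j, hj1, hj2⟩ : ∃ j, j ≠ j₁ ∧ j ≠ j₂ := by
      clear * -
      revert j₁ j₂
      decide
    obtain ⟨p, hp0, hp⟩ := h.exists_abs_eq_mul_abs hki hkl hil
    obtain ⟨r, hr0, hr⟩ := h'.exists_abs_eq_mul_abs hj1 hj2 hj
    refine ⟨j, p * s₁ * |d l| / (s₂ * |e j₂| * r), ?_⟩
    rw [hp, hr]
    field_simp
    linear_combination |d l| * hquot

end IsSqrtBasis

end Field

/-! ### Square roots in tame and in totally real fields -/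

section Tame

variable {K : Type*} [Field K] [NumberField K]

/-- If twice an element prime to `P` is a square, then `P` has even ramification over `2`. -/
theorem two_dvd_ramificationIdx {P : Ideal (𝓞 K)} [P.IsPrime]
    [P.LiesOver (Ideal.span {((2 : ℕ) : ℤ)})] {β γ : 𝓞 K} (h : β ^ 2 = 2 * γ) (hγ : γ ∉ P) :
    2 ∣ P.ramificationIdx ℤ := by
  classical
  have hmap : (Ideal.span {((2 : ℕ) : ℤ)}).map (algebraMap ℤ (𝓞 K)) = Ideal.span {2} := by
    rw [Ideal.map_span, Set.image_singleton]
    simp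
  have h20 : (Ideal.span {(2 : 𝓞 K)}) ≠ ⊥ := by
    rw [Ne, Ideal.span_singleton_eq_bot]
    exact two_ne_zero
  have hγ0 : (Ideal.span {γ}) ≠ ⊥ := by
    rw [Ne, Ideal.span_singleton_eq_bot]
    rintro rfl
    exact hγ P.zero_mem
  rw [Ideal.IsDedekindDomain.ramificationIdx_eq_normalizedFactors_count
    (Ideal.span {((2 : ℕ) : ℤ)}) P (by rwa [hmap]), hmap]
  have h1 : (Ideal.span {β}) ^ 2 = Ideal.span {2} * Ideal.span {γ} := by
    rw [Ideal.span_singleton_pow, Ideal.span_singleton_mul_span_singleton, h]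
  have h2 := congrArg (fun I => (UniqueFactorizationMonoid.normalizedFactors I).count P) h1
  simp only [UniqueFactorizationMonoid.normalizedFactors_pow,
    UniqueFactorizationMonoid.normalizedFactors_mul h20 hγ0, Multiset.count_nsmul,
    Multiset.count_add] at h2
  have h3 : (UniqueFactorizationMonoid.normalizedFactors (Ideal.span {γ})).count P = 0 := by
    rw [Multiset.count_eq_zero]
    intro hmem
    have := Ideal.dvd_iff_le.1 (UniqueFactorizationMonoid.dvd_of_mem_normalizedFactors hmem)
    exact hγ (this (Ideal.mem_span_singleton_self γ))
  exact ⟨_, (h2.trans (by rw [h3, add_zero])).symm⟩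

/-- A squarefree integer with a square root in a tame field is `1` modulo `4`. -/
theorem IsTame.emod_four_eq_one (hK : IsTame K) {m : ℤ} (hm : Squarefree m) {x : K}
    (hx : x ^ 2 = m) : m % 4 = 1 := by
  have hint : IsIntegral ℤ x := by
    refine IsIntegral.of_pow two_pos ?_
    rw [hx]
    exact isIntegral_algebraMap (x := m)
  let α : 𝓞 K := ⟨x, hint⟩
  have hα : α ^ 2 = m := by
    apply RingOfIntegers.ext
    have hv : algebraMap (𝓞 K) K α = x := rfl
    simpa [hv] using hx
  have hprime : (Ideal.span {((2 : ℕ) : ℤ)}).IsPrime := by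
    rw [Ideal.span_singleton_prime (by norm_num)]
    exact Nat.prime_iff_prime_int.1 Nat.prime_two
  obtain ⟨⟨P, hP, hlies⟩⟩ : Nonempty ((Ideal.span {((2 : ℕ) : ℤ)}).primesOver (𝓞 K)) :=
    inferInstance
  have h2P : (2 : 𝓞 K) ∈ P := by
    have h2 : (2 : ℤ) ∈ P.under ℤ := by
      rw [← hlies.over]
      exact Ideal.mem_span_singleton_self _
    simpa using h2
  have hodd : ∀ k : ℤ, ((2 * k + 1 : ℤ) : 𝓞 K) ∉ P := by
    intro k hk
    refine hP.ne_top (P.eq_top_iff_one.2 ?_)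
    have := P.sub_mem hk (P.mul_mem_right (k : 𝓞 K) h2P)
    push_cast at this
    simpa using this
  have hcon : ∀ β γ : 𝓞 K, β ^ 2 = 2 * γ → γ ∈ P := fun β γ h => by
    by_contra hγ
    exact hK 2 Nat.prime_two P hP hlies (two_dvd_ramificationIdx h hγ)
  have h0 : m % 4 ≠ 0 := fun h => by
    have h4 : (2 : ℤ) * 2 ∣ m := Int.dvd_of_emod_eq_zero h
    have := Int.isUnit_iff.1 (hm 2 h4)
    omega
  have h2 : m % 4 ≠ 2 := fun h => by
    obtain ⟨k, rfl⟩ : ∃ k, m = 2 * (2 * k + 1) := ⟨m / 4, by omega⟩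
    exact hodd k (hcon α _ (by rw [hα]; push_cast; ring))
  have h3 : m % 4 ≠ 3 := fun h => by
    obtain ⟨k, rfl⟩ : ∃ k, m = 4 * k + 3 := ⟨m / 4, by omega⟩
    -- `(1 + α)² = 2 (2k + 2 + α)`, and `α` is prime to `2`
    have h5 := hcon (1 + α) (2 * (k + 1) + α) (by
      have := hα
      push_cast at this
      linear_combination this)
    have h6 : α ∈ P := by
      have := P.sub_mem h5 (P.mul_mem_right ((k : 𝓞 K) + 1) h2P)
      simpa using this
    refine hodd (2 * k + 1) ?_
    have : ((2 * (2 * k + 1) + 1 : ℤ) : 𝓞 K) = α * α := by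
      rw [← pow_two, hα]
      push_cast
      ring
    rw [this]
    exact P.mul_mem_left α h6
  omega

theorem exists_squarefree_mul_sq {q : ℚ} (hq : q ≠ 0) :
    ∃ (m : ℤ) (r : ℚ), Squarefree m ∧ r ≠ 0 ∧ q = m * r ^ 2 := by
  obtain ⟨a, b, hab, ha⟩ := Nat.sq_mul_squarefree (q.num * q.den).natAbs
  have hden : (q.den : ℚ) ≠ 0 := by exact_mod_cast q.den_nz
  have hqnd : q = q.num * q.den / q.den ^ 2 := by
    rw [pow_two, mul_div_mul_right _ _ hden, Rat.num_div_den]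
  have hb : b ≠ 0 := by
    rintro rfl
    have : q.num * q.den = 0 := Int.natAbs_eq_zero.1 (by rw [← hab]; simp)
    rw [hqnd, ← Int.cast_natCast q.den, ← Int.cast_mul, this] at hq
    simp at hq
  have hsf : Squarefree (a : ℤ) := Int.squarefree_natCast.2 ha
  have hbq : (b : ℚ) ≠ 0 := by exact_mod_cast hb
  rcases Int.natAbs_eq (q.num * q.den) with h | h
  · refine ⟨a, b / q.den, hsf, div_ne_zero hbq hden, ?_⟩
    have h' : (q.num * q.den : ℚ) = b ^ 2 * a := by rw [← hab] at h; exact_mod_cast h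
    conv_lhs => rw [hqnd, h']
    push_cast
    ring
  · refine ⟨-a, b / q.den, fun x hx => hsf x (dvd_neg.1 hx), div_ne_zero hbq hden, ?_⟩
    have h' : (q.num * q.den : ℚ) = -(b ^ 2 * a) := by rw [← hab] at h; exact_mod_cast h
    conv_lhs => rw [hqnd, h']
    push_cast
    ring

/-- Two tame fields cannot contain square roots of opposite rational numbers: up to squares these
are a squarefree `m` and `-m`, which are not both `1` modulo `4`. -/
theorem IsTame.sq_ne_neg (hK : IsTame K) {L : Type*} [Field L] [NumberField L] (hL : IsTame L)
    {q : ℚ} (hq : q ≠ 0) {x : K} (hx : x ^ 2 = algebraMap ℚ K q) (y : L) :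
    y ^ 2 ≠ algebraMap ℚ L (-q) := by
  intro hy
  obtain ⟨m, r, hm, hr, rfl⟩ := exists_squarefree_mul_sq hq
  have h1 : m % 4 = 1 := by
    refine hK.emod_four_eq_one hm (x := x / algebraMap ℚ K r) ?_
    rw [div_pow, hx]
    simp [hr]
  have h2 : (-m) % 4 = 1 := by
    refine hL.emod_four_eq_one (fun x hx => hm x (dvd_neg.1 hx)) (x := y / algebraMap ℚ L r) ?_
    have hr' : (r : L) ≠ 0 := by exact_mod_cast hr
    rw [div_pow, hy]
    simp only [map_neg, map_mul, map_pow, eq_ratCast, Rat.cast_intCast]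
    push_cast
    field_simp
  omega

end Tame

/-! ### The shape determines the field -/

section Main

variable {K : Type*} [Field K] [NumberField K]

theorem nonneg_of_isTotallyReal [IsTotallyReal K] {q : ℚ} {x : K}
    (hx : x ^ 2 = algebraMap ℚ K q) : 0 ≤ q := by
  obtain ⟨φ⟩ : Nonempty (K →+* ℂ) := inferInstance
  have hφ := IsTotallyReal.complexEmbedding_isReal φ
  have h1 : (hφ.embedding x) ^ 2 = q := by rw [← map_pow, hx]; simp
  have h2 : (0 : ℝ) ≤ q := h1 ▸ sq_nonneg _
  exact_mod_cast h2

/-- The shape determines the quadratic subfields up to the signs of their discriminants. Hence it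
determines the field as soon as a nonzero rational number and its opposite cannot both have square
roots in `K`, nor both in `L`, nor one in `K` and the other in `L`. -/
theorem nonempty_algEquiv_of_quarticShape_eq {L : Type*} [Field L] [NumberField L]
    (hK : IsV4Quartic K) (hL : IsV4Quartic L)
    (hKK : ∀ q : ℚ, q ≠ 0 → ∀ x y : K, x ^ 2 = algebraMap ℚ K q → y ^ 2 ≠ algebraMap ℚ K (-q))
    (hLL : ∀ q : ℚ, q ≠ 0 → ∀ x y : L, x ^ 2 = algebraMap ℚ L q → y ^ 2 ≠ algebraMap ℚ L (-q))
    (hKL : ∀ q : ℚ, q ≠ 0 → ∀ (x : K) (y : L), x ^ 2 = algebraMap ℚ K q →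
      y ^ 2 ≠ algebraMap ℚ L (-q))
    (hsh : quarticShape K = quarticShape L) : Nonempty (K ≃ₐ[ℚ] L) := by
  obtain ⟨g, α, d, h⟩ := exists_isSqrtBasis hK
  obtain ⟨g', β, e, h'⟩ := exists_isSqrtBasis hL
  have := hK.isGalois
  have := hL.isGalois
  have hns : ∀ i s, |d i| ≠ s ^ 2 := by
    intro i s hs
    rcases abs_choice (d i) with h1 | h1
    · exact h.d_ne_sq i s (h1 ▸ hs)
    · refine hKK _ (h.d_ne_zero i) _ (algebraMap ℚ K s) (h.sq_eq i) ?_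
      rw [← h1, hs, map_pow]
  have hns' : ∀ i s, |e i| ≠ s ^ 2 := by
    intro i s hs
    rcases abs_choice (e i) with h1 | h1
    · exact h'.d_ne_sq i s (h1 ▸ hs)
    · refine hLL _ (h'.d_ne_zero i) _ (algebraMap ℚ L s) (h'.sq_eq i) ?_
      rw [← h1, hs, map_pow]
  refine h.nonempty_algEquiv (hK.finrank_eq.trans hL.finrank_eq.symm) fun k => ?_
  obtain ⟨j, s, hs⟩ := h.exists_abs_eq hK.finrank_eq h' hL.finrank_eq hns hns' hsh k
  have hsq : ((β j : L) * algebraMap ℚ L s) ^ 2 = algebraMap ℚ L (s ^ 2 * e j) := by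
    rw [mul_pow, h'.sq_eq, map_mul, map_pow, mul_comm]
  refine ⟨(β j : L) * algebraMap ℚ L s, ?_⟩
  have habs : |d k| = |s ^ 2 * e j| := by rw [hs, abs_mul, abs_sq]
  rcases abs_eq_abs.1 habs with h1 | h1
  · rw [hsq, h1]
  · refine absurd hsq ?_
    rw [show s ^ 2 * e j = -d k by rw [h1, neg_neg]]
    exact hKL _ (h.d_ne_zero k) _ _ (h.sq_eq k)

end Main

end QuarticShape

/-- The shape determines a totally real `V₄`-quartic field among all totally real `V₄`-quartic
fields, and a tame `V₄`-quartic field among all tame `V₄`-quartic fields (up to isomorphism). -/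
theorem corollary4p12 (K : Type*) [Field K] [NumberField K] (L : Type*) [Field L] [NumberField L]
    (hK : QuarticShape.IsV4Quartic K) (hL : QuarticShape.IsV4Quartic L) :
    (NumberField.IsTotallyReal K → NumberField.IsTotallyReal L →
      QuarticShape.quarticShape K = QuarticShape.quarticShape L → Nonempty (K ≃ₐ[ℚ] L)) ∧
    (QuarticShape.IsTame K → QuarticShape.IsTame L →
      QuarticShape.quarticShape K = QuarticShape.quarticShape L → Nonempty (K ≃ₐ[ℚ] L)) := by
  refine ⟨fun hK' hL' hsh => ?_, fun hK' hL' hsh => ?_⟩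
  · have hpos : ∀ q : ℚ, q ≠ 0 → 0 ≤ q → ¬ 0 ≤ -q := fun q hq h1 h2 =>
      hq (le_antisymm (neg_nonneg.1 h2) h1)
    exact QuarticShape.nonempty_algEquiv_of_quarticShape_eq hK hL
      (fun q hq x y hx hy => hpos q hq (QuarticShape.nonneg_of_isTotallyReal hx)
        (QuarticShape.nonneg_of_isTotallyReal hy))
      (fun q hq x y hx hy => hpos q hq (QuarticShape.nonneg_of_isTotallyReal hx)
        (QuarticShape.nonneg_of_isTotallyReal hy))
      (fun q hq x y hx hy => hpos q hq (QuarticShape.nonneg_of_isTotallyReal hx)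
        (QuarticShape.nonneg_of_isTotallyReal hy)) hsh
  · exact QuarticShape.nonempty_algEquiv_of_quarticShape_eq hK hL
      (fun q hq x y hx => hK'.sq_ne_neg hK' hq hx y)
      (fun q hq x y hx => hL'.sq_ne_neg hL' hq hx y)
      (fun q hq x y hx => hK'.sq_ne_neg hL' hq hx y) hsh
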